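/- Let $n \ge 0$ be an integer and let $T_n$ be a polynomial of degree $n$ with complex coefficients. Put $T_n^{-1}([-1,1]) := \{z \in \mathbb{C} : T_n(z) \in [-1,1]\}$, where $[-1,1]$ is the real interval regarded as a subset of $\mathbb{C}$. Then $T_n^{-1}([-1,1])$ is connected (and nonempty) if and only if every zero $z \in \mathbb{C}$ of the derivative $T_n'$ lies in $T_n^{-1}([-1,1])$. -/

import Mathlib

open Polynomial Filter Topology Set

/-! Write J for `joukowski`, a universal covering of the complement of [-1,1], and n for the degree,
assumed positive. If all critical values lie in [-1,1], then T is a covering over the complement, so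
J lifts to g with T ∘ g = J. Near infinity g grows like a constant times exp(ζ/n), where J = cosh ζ,
so the translates of g by 2πik, 0 ≤ k < n, differ and fill the fibres: g maps onto the preimage of
the complement. The g-images of the half-planes re s < -m are connected, and their closures are
compact and decrease to the preimage of [-1,1], which is therefore connected. Conversely, cut [-1,1]
at N + 1 points, among them ±1 and all critical values in it. The preimage becomes a graph with at
most Nn edges and (N + 1)n - c vertices, where c counts, with multiplicity, the critical points in
it. Connectedness gives vertices ≤ edges + 1, so c ≥ n - 1, the degree of T'. No critical point is
left outside. -/

/-! ### Lifting through a polynomial away from its critical values -/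

/-- A continuous function into the plane that avoids the critical values of a polynomial lifts
through it. -/
theorem Polynomial.exists_lift {A : Type*} [TopologicalSpace A] [SimplyConnectedSpace A]
    [LocallyPathConnectedSpace A] (T : ℂ[X]) (f : C(A, ℂ))
    (hf : ∀ a z, T.derivative.eval z = 0 → T.eval z ≠ f a) {a : A} {z : ℂ}
    (hz : T.eval z = f a) : ∃ g : C(A, ℂ), g a = z ∧ ∀ b, T.eval (g b) = f b := by
  obtain ⟨g, ⟨h1, h2⟩, -⟩ := T.isCoveringMapOn_eval.existsUnique_continuousMap_lifts f hz
    (by rintro b ⟨w, hw, h⟩; exact hf b w hw h)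
  exact ⟨g, h1, fun b => congrFun h2 b⟩

/-- Two lifts through a polynomial that agree at one point are equal. -/
theorem Polynomial.lift_unique {A : Type*} [TopologicalSpace A] [SimplyConnectedSpace A]
    [LocallyPathConnectedSpace A] (T : ℂ[X]) (f : C(A, ℂ))
    (hf : ∀ a z, T.derivative.eval z = 0 → T.eval z ≠ f a) {g g' : C(A, ℂ)}
    (hg : ∀ b, T.eval (g b) = f b) (hg' : ∀ b, T.eval (g' b) = f b) {a : A} (h : g a = g' a) :
    g = g' := by
  obtain ⟨G, -, h3⟩ := T.isCoveringMapOn_eval.existsUnique_continuousMap_lifts f (hg a)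
    (by rintro b ⟨w, hw, h⟩; exact hf b w hw h)
  have h1 : g = G := h3 g ⟨rfl, _root_.funext hg⟩
  have h2 : g' = G := h3 g' ⟨h.symm, _root_.funext hg'⟩
  rw [h1, h2]

/-! ### Growth at infinity and continuous roots -/

/-- The quotient of a polynomial by its leading power tends to the leading coefficient at
infinity. -/
theorem Polynomial.tendsto_eval_div_pow_cobounded (T : ℂ[X]) :
    Tendsto (fun z => T.eval z / z ^ T.natDegree) (Bornology.cobounded ℂ)
      (𝓝 T.leadingCoeff) := by
  -- T(z) / z ^ n is the reversed polynomial at z⁻¹, and z⁻¹ tends to 0.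
  have h0 : Tendsto (fun z : ℂ => T.reverse.eval z⁻¹) (Bornology.cobounded ℂ)
      (𝓝 (T.reverse.eval 0)) :=
    (T.reverse.continuous.tendsto 0).comp tendsto_inv₀_cobounded
  rw [← coeff_zero_eq_eval_zero, coeff_zero_reverse] at h0
  refine h0.congr' ?_
  have : ∀ᶠ z : ℂ in Bornology.cobounded ℂ, z ≠ 0 := Bornology.eventually_ne_cobounded 0
  filter_upwards [this] with z hz
  let _ := invertibleOfNonzero hz
  have := eval₂_reverse_mul_pow (RingHom.id ℂ) z T
  simp only [invOf_eq_inv] at this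
  rw [eq_div_iff (pow_ne_zero _ hz)]
  exact this

/-- A continuous `n`-th root of a function with values in a slit plane returns to its value when
its `n`-th power does. -/
theorem eq_of_pow_eq_of_mem_slitPlane {n : ℕ} (hn : n ≠ 0) {b : ℂ} {φ : ℝ → ℂ}
    (hφ : Continuous φ) (h : ∀ t ∈ Icc (0 : ℝ) 1, b * φ t ^ n ∈ Complex.slitPlane)
    (h01 : φ 0 ^ n = φ 1 ^ n) : φ 0 = φ 1 := by
  have hn' : (n : ℂ) ≠ 0 := by exact_mod_cast hn
  -- Divide φ by the principal n-th root of b φ ^ n. The quotient is continuous with values in the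
  -- finite set of n-th roots of b⁻¹, hence constant.
  set r : ℝ → ℂ := fun t => φ t / Complex.exp (Complex.log (b * φ t ^ n) / n) with hr
  have hrc : ContinuousOn r (Icc 0 1) := by
    refine hφ.continuousOn.div ?_ (fun t _ => Complex.exp_ne_zero _)
    refine Complex.continuous_exp.comp_continuousOn (ContinuousOn.div_const ?_ _)
    exact ContinuousOn.clog (by fun_prop) h
  have hb : ∀ t ∈ Icc (0 : ℝ) 1, r t ^ n = b⁻¹ := by
    intro t ht
    have h0 := Complex.slitPlane_ne_zero (h t ht)
    rw [hr]
    simp only [div_pow]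
    rw [← Complex.exp_nat_mul, mul_div_cancel₀ _ hn', Complex.exp_log h0]
    have := left_ne_zero_of_mul h0
    have := right_ne_zero_of_mul h0
    field_simp
  have hfin : {w : ℂ | w ^ n = b⁻¹}.Finite := by
    have := (nthRoots n b⁻¹).toFinset.finite_toSet
    refine this.subset fun w hw => ?_
    simpa [mem_nthRoots (Nat.pos_of_ne_zero hn)] using hw
  have hsub : (r '' Icc 0 1).Subsingleton :=
    (hfin.subset (by rintro _ ⟨t, ht, rfl⟩; exact hb t ht)).countable.isTotallyDisconnected _
      subset_rfl (isPreconnected_Icc.image r hrc)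
  have := hsub ⟨0, by simp, rfl⟩ ⟨1, by simp, rfl⟩
  simp only [hr, h01] at this
  rwa [div_left_inj' (Complex.exp_ne_zero _)] at this

/-! ### The covering of the complement of [-1,1] -/

theorem Complex.sinh_re_le_norm_cosh (z : ℂ) : Real.sinh z.re ≤ ‖Complex.cosh z‖ := by
  have h1 : ‖Complex.exp z‖ - ‖Complex.exp (-z)‖ ≤ ‖Complex.exp z + Complex.exp (-z)‖ := by
    have := norm_sub_norm_le (Complex.exp z) (-Complex.exp (-z))
    simpa using this
  rw [Complex.cosh, norm_div, Real.sinh_eq]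
  simp only [Complex.norm_exp, Complex.neg_re] at h1
  simp only [Complex.norm_ofNat]
  gcongr

theorem Complex.cosh_re_im (x y : ℝ) : Complex.cosh (x + y * Complex.I) =
    ((Real.cosh x * Real.cos y : ℝ) : ℂ) + ((Real.sinh x * Real.sin y : ℝ) : ℂ) * Complex.I := by
  rw [Complex.cosh_add, Complex.cosh_mul_I, Complex.sinh_mul_I]
  push_cast
  ring

/-- A parametrization of the complement of the segment `[-1, 1]` by the plane: the hyperbolic
cosine composed with a homeomorphism onto the right half-plane. -/
noncomputable def joukowski : C(ℂ, ℂ) where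
  toFun s := Complex.cosh (Real.exp s.re + s.im * Complex.I)
  continuous_toFun := by fun_prop

theorem joukowski_apply (s : ℂ) :
    joukowski s = Complex.cosh (Real.exp s.re + s.im * Complex.I) := rfl

/-- The segment `[-1, 1]` in the complex plane. -/
def unitSegment : Set ℂ := (fun x : ℝ => (x : ℂ)) '' Icc (-1 : ℝ) 1

theorem mem_unitSegment {w : ℂ} : w ∈ unitSegment ↔ |w.re| ≤ 1 ∧ w.im = 0 := by
  constructor
  · rintro ⟨x, hx, rfl⟩
    exact ⟨abs_le.2 hx, rfl⟩
  · rintro ⟨h1, h2⟩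
    exact ⟨w.re, abs_le.1 h1, Complex.ext rfl h2.symm⟩

theorem joukowski_re_im (s : ℂ) : joukowski s =
    ((Real.cosh (Real.exp s.re) * Real.cos s.im : ℝ) : ℂ) +
      ((Real.sinh (Real.exp s.re) * Real.sin s.im : ℝ) : ℂ) * Complex.I := by
  rw [joukowski_apply, Complex.cosh_re_im]

/-- A real value forces sin = 0, hence |cos| = 1, and then the real part has modulus cosh > 1. -/
theorem joukowski_notMem (s : ℂ) : joukowski s ∉ unitSegment := by
  rw [mem_unitSegment, joukowski_re_im]
  rintro ⟨h1, h2⟩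
  simp only [Complex.add_re, Complex.ofReal_re, Complex.mul_re, Complex.ofReal_im, Complex.I_re,
    Complex.I_im, Complex.add_im, Complex.mul_im] at h1 h2
  have hs : 0 < Real.sinh (Real.exp s.re) := Real.sinh_pos_iff.2 (Real.exp_pos _)
  have hc : 1 < Real.cosh (Real.exp s.re) := Real.one_lt_cosh.2 (Real.exp_pos _).ne'
  have h3 : Real.sin s.im = 0 := by
    have : Real.sinh (Real.exp s.re) * Real.sin s.im = 0 := by linarith
    exact (mul_eq_zero.1 this).resolve_left hs.ne'
  have h4 : |Real.cos s.im| = 1 := by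
    have := Real.sin_sq_add_cos_sq s.im
    rw [h3] at this
    rw [← sq_eq_sq₀ (abs_nonneg _) zero_le_one, sq_abs]
    linarith
  have h5 : |Real.cosh (Real.exp s.re) * Real.cos s.im| ≤ 1 := by
    refine le_trans (le_of_eq ?_) h1
    congr 1
    ring
  rw [abs_mul, h4, mul_one, abs_of_pos (by linarith)] at h5
  linarith

theorem joukowski_add_period (s : ℂ) (k : ℤ) :
    joukowski (s + k * (2 * Real.pi * Complex.I)) = joukowski s := by
  rw [joukowski_re_im, joukowski_re_im]
  have h1 : (s + k * (2 * Real.pi * Complex.I)).re = s.re := by simp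
  have h2 : (s + k * (2 * Real.pi * Complex.I)).im = s.im + k * (2 * Real.pi) := by simp
  rw [h1, h2, Real.cos_add_int_mul_two_pi, Real.sin_add_int_mul_two_pi]

/-- The hyperbolic cosine of a point off the imaginary axis is a value of the parametrization. -/
theorem exists_joukowski_eq_cosh {ζ : ℂ} (h : Complex.cosh ζ ∉ unitSegment) :
    ∃ s : ℂ, joukowski s = Complex.cosh ζ ∧ Real.exp s.re = |ζ.re| := by
  have key : ∀ ζ : ℂ, 0 < ζ.re →
      ∃ s : ℂ, joukowski s = Complex.cosh ζ ∧ Real.exp s.re = |ζ.re| := by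
    intro ζ h
    refine ⟨⟨Real.log ζ.re, ζ.im⟩, ?_, ?_⟩
    · rw [joukowski_apply]
      simp only [Real.exp_log h, Complex.re_add_im]
    · simp only [Real.exp_log h, abs_of_pos h]
  rcases lt_trichotomy ζ.re 0 with h0 | h0 | h0
  · have := key (-ζ) (by simpa using h0)
    simpa using this
  · exfalso
    apply h
    have : ζ = ((0 : ℝ) : ℂ) + ζ.im * Complex.I := by
      apply Complex.ext <;> simp [h0]
    rw [this, Complex.cosh_re_im, mem_unitSegment]
    simp [Real.abs_cos_le_one, -Complex.ofReal_cos]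
  · exact key ζ h0

theorem Complex.exists_cosh_eq (w : ℂ) : ∃ ζ : ℂ, Complex.cosh ζ = w := by
  obtain ⟨x, hx⟩ := Complex.cos_surjective w
  exact ⟨x * Complex.I, by rw [Complex.cosh_mul_I, hx]⟩

theorem tendsto_joukowski_cobounded :
    Tendsto joukowski (comap Complex.re atTop) (Bornology.cobounded ℂ) := by
  rw [← tendsto_norm_atTop_iff_cobounded]
  have h1 : Tendsto (fun s : ℂ => Real.sinh (Real.exp s.re)) (comap Complex.re atTop) atTop := by
    have : Tendsto Real.sinh atTop atTop :=
      tendsto_atTop_mono' _ ((eventually_ge_atTop 0).mono fun x hx =>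
        Real.self_le_sinh_iff.2 hx) tendsto_id
    exact this.comp (Real.tendsto_exp_atTop.comp tendsto_comap)
  refine tendsto_atTop_mono (fun s => ?_) h1
  have := Complex.sinh_re_le_norm_cosh (Real.exp s.re + s.im * Complex.I)
  rw [joukowski_apply]
  simpa [-Complex.ofReal_exp] using this

/-- 2 cosh ζ · exp(-ζ) = 1 + exp(-2ζ). The filter makes the limit uniform in the imaginary part, so
that it can be used along whole vertical segments. -/
theorem tendsto_joukowski_mul_exp :
    Tendsto (fun s => 2 * joukowski s * Complex.exp (-(Real.exp s.re + s.im * Complex.I)))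
      (comap Complex.re atTop) (𝓝 1) := by
  have h : ∀ s : ℂ, 2 * joukowski s * Complex.exp (-(Real.exp s.re + s.im * Complex.I)) =
      1 + Complex.exp (-2 * (Real.exp s.re + s.im * Complex.I)) := by
    intro s
    rw [joukowski_apply, Complex.cosh, mul_div_cancel₀ _ two_ne_zero, add_mul, ← Complex.exp_add,
      ← Complex.exp_add]
    ring_nf
    simp
  simp_rw [h]
  have h2 : Tendsto (fun s : ℂ => Complex.exp (-2 * (Real.exp s.re + s.im * Complex.I)))
      (comap Complex.re atTop) (𝓝 0) := by
    rw [tendsto_zero_iff_norm_tendsto_zero]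
    simp_rw [Complex.norm_exp]
    have : ∀ s : ℂ, (-2 * (Real.exp s.re + s.im * Complex.I) : ℂ).re = -(2 * Real.exp s.re) := by
      intro s
      simp [-Complex.ofReal_exp]
    simp_rw [this]
    exact Real.tendsto_exp_neg_atTop_nhds_zero.comp
      ((Real.tendsto_exp_atTop.comp tendsto_comap).const_mul_atTop two_pos)
  simpa using h2.const_add 1

/-! ### Monodromy of the lift near infinity -/

theorem Polynomial.exists_eval_eq {T : ℂ[X]} (hT : 0 < T.degree) (w : ℂ) :
    ∃ z, T.eval z = w := by
  obtain ⟨z, hz⟩ := IsAlgClosed.exists_root (T - C w) (by rw [degree_sub_C hT]; exact hT.ne')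
  exact ⟨z, by simpa [sub_eq_zero] using hz⟩

/-- Far to the right, a lift of the parametrization through a polynomial of degree `n` takes
the same value at translates by multiples of `2πi` only if `n` divides the multiple. -/
theorem Polynomial.exists_forall_dvd_of_joukowski_lift {T : ℂ[X]} (hT : T.natDegree ≠ 0)
    {g : C(ℂ, ℂ)} (hg : ∀ s, T.eval (g s) = joukowski s) :
    ∃ R : ℝ, ∀ s : ℂ, R ≤ s.re → ∀ k : ℤ,
      g (s + k * (2 * Real.pi * Complex.I)) = g s → (T.natDegree : ℤ) ∣ k := by
  set n := T.natDegree with hn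
  set a := T.leadingCoeff with ha
  have hn' : (n : ℂ) ≠ 0 := by exact_mod_cast hT
  have ha0 : a ≠ 0 := by
    rw [ha, Ne, leadingCoeff_eq_zero]
    rintro rfl
    simp at hn
    exact hT hn
  have hgc : Tendsto g (comap Complex.re atTop) (Bornology.cobounded ℂ) := by
    rw [Metric.cobounded_eq_cocompact]
    refine Tendsto.mono_right (tendsto_comap_iff.2 ?_) (comap_cocompact_le T.continuous)
    rw [← Metric.cobounded_eq_cocompact]
    exact tendsto_joukowski_cobounded.congr fun s => (hg s).symm
  set ζ : ℂ → ℂ := fun s => Real.exp s.re + s.im * Complex.I with hζ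
  -- φ removes the expected growth from g; 2aφ ^ n tends to 1, so φ cannot change its branch of the
  -- n-th root along a vertical segment far to the right.
  set φ : ℂ → ℂ := fun s => g s * Complex.exp (-(ζ s) / n) with hφ
  have hφc : Continuous φ := by
    simp only [hφ, hζ]
    fun_prop
  have hφn : ∀ s, φ s ^ n = g s ^ n * Complex.exp (-(ζ s)) := by
    intro s
    simp only [hφ]
    rw [mul_pow, ← Complex.exp_nat_mul, mul_div_cancel₀ _ hn']
  have hlim : Tendsto (fun s => 2 * a * φ s ^ n) (comap Complex.re atTop) (𝓝 1) := by
    have h1 := (T.tendsto_eval_div_pow_cobounded.comp hgc).inv₀ ha0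
    have h2 := (h1.const_mul a).mul tendsto_joukowski_mul_exp
    rw [← ha, mul_inv_cancel₀ ha0, one_mul] at h2
    refine h2.congr' ?_
    filter_upwards [tendsto_joukowski_cobounded.eventually_ne_cobounded 0] with s hs
    simp only [Function.comp_apply, hg, hφn]
    rw [inv_div]
    field_simp
    simp only [hζ, hn]
  have hev := hlim.eventually (Complex.isOpen_slitPlane.mem_nhds Complex.one_mem_slitPlane)
  rw [eventually_comap, eventually_atTop] at hev
  obtain ⟨R, hR⟩ := hev
  refine ⟨R, fun s hs k hk => ?_⟩
  have hs' := hR s.re hs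
  have hp := eq_of_pow_eq_of_mem_slitPlane (n := n) (b := 2 * a)
    (φ := fun t => φ (s + t * (k * (2 * Real.pi * Complex.I)))) hT (by fun_prop)
    (fun t _ => hs' _ (by simp))
  have hζk : ζ (s + k * (2 * Real.pi * Complex.I)) = ζ s + k * (2 * Real.pi * Complex.I) := by
    simp [hζ]
    ring
  have hφk : φ (s + k * (2 * Real.pi * Complex.I)) =
      φ s * Complex.exp (-(k * (2 * Real.pi * Complex.I)) / n) := by
    simp only [hφ]
    rw [hk, hζk, mul_assoc (g s), ← Complex.exp_add]
    ring_nf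
  have hexp : Complex.exp (-(k * (2 * Real.pi * Complex.I)) / n) ^ n = 1 := by
    rw [← Complex.exp_nat_mul, mul_div_cancel₀ _ hn', Complex.exp_neg,
      Complex.exp_int_mul_two_pi_mul_I, inv_one]
  simp only [Complex.ofReal_zero, zero_mul, add_zero, Complex.ofReal_one, one_mul] at hp
  rw [hφk, mul_pow (φ s), hexp, mul_one] at hp
  have hφ0 : φ s ≠ 0 := by
    have := Complex.slitPlane_ne_zero (hs' s rfl)
    have := right_ne_zero_of_mul this
    exact fun h => this (by rw [h, zero_pow hT])
  have h1 : Complex.exp (-(k * (2 * Real.pi * Complex.I)) / n) = 1 :=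
    (mul_right_eq_self₀.1 (hp rfl).symm).resolve_right hφ0
  obtain ⟨m, hm⟩ := Complex.exp_eq_one_iff.1 h1
  rw [div_eq_iff hn'] at hm
  have hpi : (2 * Real.pi * Complex.I : ℂ) ≠ 0 := Complex.two_pi_I_ne_zero
  have h2 : (k : ℂ) = -(m * n) := by
    apply mul_right_cancel₀ hpi
    linear_combination -hm
  have h3 : k = n * (-m) := by
    have : (k : ℂ) = ((n * (-m) : ℤ) : ℂ) := by
      rw [h2]
      push_cast
      ring
    exact_mod_cast this
  exact ⟨-m, h3⟩

/-- If the critical values of a polynomial lie in `[-1, 1]`, then the translates of one lift of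
the parametrization reach all points over the complement of `[-1, 1]`. -/
theorem Polynomial.exists_eq_joukowski_lift {T : ℂ[X]} (hT : T.natDegree ≠ 0)
    (hcrit : ∀ z, T.derivative.eval z = 0 → T.eval z ∈ unitSegment)
    {g : C(ℂ, ℂ)} (hg : ∀ s, T.eval (g s) = joukowski s) {s z : ℂ}
    (hz : T.eval z = joukowski s) : ∃ k : ℤ, z = g (s + k * (2 * Real.pi * Complex.I)) := by
  have hf : ∀ a z, T.derivative.eval z = 0 → T.eval z ≠ joukowski a :=
    fun a z h h' => joukowski_notMem a (h' ▸ hcrit z h)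
  obtain ⟨R, hR⟩ := exists_forall_dvd_of_joukowski_lift hT hg
  have hR1 : ∀ k : ℤ, R ≤ ((R : ℂ) + k * (2 * Real.pi * Complex.I)).re := by simp
  set n := T.natDegree with hn
  have hT0 : T - C (joukowski R) ≠ 0 := by
    intro h
    rw [sub_eq_zero] at h
    rw [h, natDegree_C] at hn
    exact hT hn
  have hdeg : (T - C (joukowski R)).natDegree = n := natDegree_sub_C
  -- These n points are distinct by the choice of R, so they exhaust the fibre over `joukowski R`,
  -- which has at most n points.
  set S := (Finset.range n).image fun k : ℕ => g (R + (k : ℤ) * (2 * Real.pi * Complex.I)) with hS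
  have hcard : S.card = n := by
    rw [hS, Finset.card_image_of_injOn, Finset.card_range]
    intro i hi j hj hij
    simp only [Finset.coe_range, mem_Iio] at hi hj
    have := hR _ (hR1 j) ((i : ℤ) - j) (by
      simp only at hij
      rw [← hij]
      congr 1
      push_cast
      ring)
    have hlt : |(i : ℤ) - j| < n := by
      rw [abs_lt]
      constructor <;> omega
    have := Int.eq_zero_of_abs_lt_dvd this hlt
    omega
  have hsub : S ⊆ (T - C (joukowski R)).roots.toFinset := by
    intro w hw
    obtain ⟨k, -, rfl⟩ := Finset.mem_image.1 hw
    rw [Multiset.mem_toFinset, mem_roots hT0, IsRoot, eval_sub, eval_C, hg,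
      joukowski_add_period, sub_self]
  have hSeq := Finset.eq_of_subset_of_card_le hsub (by
    rw [hcard, ← hdeg]
    exact (Multiset.toFinset_card_le _).trans (card_roots' _))
  -- The lift through z meets a translate of g over R, so the two coincide everywhere.
  obtain ⟨g', hg's, hg'⟩ := T.exists_lift joukowski hf hz
  have hmem : g' R ∈ S := by
    rw [hSeq, Multiset.mem_toFinset, mem_roots hT0, IsRoot, eval_sub, eval_C, hg', sub_self]
  obtain ⟨k, -, hk⟩ := Finset.mem_image.1 hmem
  refine ⟨k, ?_⟩
  let gk : C(ℂ, ℂ) := ⟨fun s => g (s + (k : ℤ) * (2 * Real.pi * Complex.I)), by fun_prop⟩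
  have : g' = gk := T.lift_unique joukowski hf hg'
    (fun b => by simp only [gk, ContinuousMap.coe_mk, hg, joukowski_add_period]) (a := (R : ℂ))
    hk.symm
  rw [← hg's, this]
  rfl

/-! ### Connectedness of the preimage as a decreasing intersection -/

/-- A splitting of the intersection thickens to disjoint open sets; by compactness they cover some S
m, which must lie in one of them. -/
theorem isPreconnected_iInter_of_antitone {X : Type*} [TopologicalSpace X] [T2Space X]
    {S : ℕ → Set X} (hanti : Antitone S) (hc : ∀ m, IsCompact (S m))
    (hconn : ∀ m, IsPreconnected (S m)) : IsPreconnected (⋂ m, S m) := by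
  have hK : IsCompact (⋂ m, S m) := (hc 0).of_isClosed_subset (isClosed_iInter fun m => (hc m).isClosed)
    (iInter_subset _ 0)
  have hcl : ∀ m, IsClosed (S m) := fun m => (hc m).isClosed
  rw [isPreconnected_iff_subset_of_fully_disjoint_closed (isClosed_iInter hcl)]
  intro u v hu hv huv hdisj
  have h1 := hK.inter_right hu
  have h2 := hK.inter_right hv
  obtain ⟨U, V, hU, hV, hKU, hKV, hUV⟩ := SeparatedNhds.of_isCompact_isCompact h1 h2
    (hdisj.mono inter_subset_right inter_subset_right)
  have hsub : (⋂ m, S m) ⊆ U ∪ V := fun x hx =>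
    (huv hx).imp (fun h => hKU ⟨hx, h⟩) fun h => hKV ⟨hx, h⟩
  obtain ⟨m, hm⟩ := exists_subset_nhds_of_isCompact hanti.directed_ge hc
    (fun x hx => (hU.union hV).mem_nhds (hsub hx))
  have := (isPreconnected_iff_subset_of_disjoint.1 (hconn m)) U V hU hV hm
    (by rw [hUV.inter_eq, inter_empty])
  refine this.imp (fun h x hx => ?_) fun h x hx => ?_
  · exact (huv hx).resolve_right fun hxv =>
      hUV.le_bot ⟨h (mem_iInter.1 hx m), hKV ⟨hx, hxv⟩⟩
  · exact (huv hx).resolve_left fun hxu =>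
      hUV.le_bot ⟨hKU ⟨hx, hxu⟩, h (mem_iInter.1 hx m)⟩

/-- Nonconstant polynomials are open maps. -/
theorem Polynomial.isOpenMap_eval {T : ℂ[X]} (hT : T.natDegree ≠ 0) :
    IsOpenMap fun z : ℂ => T.eval z := by
  have han : AnalyticOnNhd ℂ (fun z : ℂ => T.eval z) univ :=
    fun z _ => T.differentiable.analyticAt z
  rcases han.is_constant_or_isOpen isPreconnected_univ with ⟨w, hw⟩ | h
  · exfalso
    apply hT
    have : T = C w := Polynomial.funext fun z => by rw [hw z trivial, eval_C]
    rw [this, natDegree_C]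
  · exact fun s hs => h s (subset_univ _) hs

theorem Complex.isOpenMap_cosh : IsOpenMap Complex.cosh := by
  have han : AnalyticOnNhd ℂ Complex.cosh univ :=
    fun z _ => Complex.differentiable_cosh.analyticAt z
  rcases han.is_constant_or_isOpen isPreconnected_univ with ⟨w, hw⟩ | h
  · exfalso
    obtain ⟨a, ha⟩ := Complex.exists_cosh_eq 0
    obtain ⟨b, hb⟩ := Complex.exists_cosh_eq 1
    rw [hw a trivial] at ha
    rw [hw b trivial, ha] at hb
    exact zero_ne_one hb
  · exact fun s hs => h s (subset_univ _) hs

theorem interior_unitSegment : interior unitSegment = ∅ := by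
  rw [interior_eq_empty_iff_dense_compl]
  have h : Dense {w : ℂ | w.im ∈ ({0}ᶜ : Set ℝ)} :=
    (dense_compl_singleton (0 : ℝ)).preimage Complex.isOpenMap_im
  refine h.mono fun w hw hw' => ?_
  exact (show w.im ≠ 0 from hw) (mem_unitSegment.1 hw').2

/-- The bounds on the values of the parametrization on a left half-plane. -/
theorem joukowski_bounds {s : ℂ} {c : ℝ} (h : s.re < c) :
    |(joukowski s).re| ≤ Real.cosh (Real.exp c) ∧ |(joukowski s).im| ≤ Real.sinh (Real.exp c) := by
  have hexp := Real.exp_lt_exp.2 h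
  have h0 := Real.exp_pos s.re
  have hre : (joukowski s).re = Real.cosh (Real.exp s.re) * Real.cos s.im := by
    rw [joukowski_re_im]; simp only [Complex.add_re, Complex.ofReal_re, Complex.re_ofReal_mul,
      Complex.I_re, mul_zero, add_zero]
  have him : (joukowski s).im = Real.sinh (Real.exp s.re) * Real.sin s.im := by
    rw [joukowski_re_im]; simp only [Complex.add_im, Complex.ofReal_im, Complex.im_ofReal_mul,
      Complex.I_im, mul_one, zero_add]
  rw [hre, him, abs_mul, abs_mul, abs_of_pos (Real.cosh_pos _),
    abs_of_pos (Real.sinh_pos_iff.2 h0)]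
  constructor
  · calc _ ≤ Real.cosh (Real.exp s.re) * 1 := by
          gcongr
          · exact Real.abs_cos_le_one _
      _ ≤ _ := by
          rw [mul_one, Real.cosh_le_cosh, abs_of_pos h0, abs_of_pos (Real.exp_pos _)]
          exact hexp.le
  · calc _ ≤ Real.sinh (Real.exp s.re) * 1 := by
          exact mul_le_mul_of_nonneg_left (Real.abs_sin_le_one _) (Real.sinh_pos_iff.2 h0).le
      _ ≤ _ := by
          rw [mul_one]
          exact Real.sinh_le_sinh.2 hexp.le

/-- If the critical values of a nonconstant polynomial lie in `[-1, 1]`, then the preimage of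
`[-1, 1]` is connected. -/
theorem Polynomial.isConnected_preimage_unitSegment {T : ℂ[X]} (hT : T.natDegree ≠ 0)
    (hcrit : ∀ z, T.derivative.eval z = 0 → T.eval z ∈ unitSegment) :
    IsConnected ((fun z : ℂ => T.eval z) ⁻¹' unitSegment) := by
  have hdeg : 0 < T.degree := natDegree_pos_iff_degree_pos.1 (Nat.pos_of_ne_zero hT)
  have hf : ∀ a z, T.derivative.eval z = 0 → T.eval z ≠ joukowski a :=
    fun a z h h' => joukowski_notMem a (h' ▸ hcrit z h)
  obtain ⟨z₀, hz₀⟩ := exists_eval_eq hdeg (joukowski 0)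
  obtain ⟨g, -, hg⟩ := T.exists_lift joukowski hf hz₀
  set H : ℕ → Set ℂ := fun m => {s : ℂ | s.re < -m} with hH
  set B : ℕ → Set ℂ := fun m => {w : ℂ | |w.re| ≤ Real.cosh (Real.exp (-m)) ∧
    |w.im| ≤ Real.sinh (Real.exp (-m))} with hB
  have hBcl : ∀ m, IsClosed (B m) := fun m =>
    (isClosed_le (f := fun w : ℂ => |w.re|) (by fun_prop) continuous_const).inter
      (isClosed_le (f := fun w : ℂ => |w.im|) (by fun_prop) continuous_const)
  have hBcomp : ∀ m, IsCompact (B m) := fun m => by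
    refine (isCompact_Icc.reProdIm isCompact_Icc).of_isClosed_subset (hBcl m)
      (s := Icc (-Real.cosh (Real.exp (-m))) (Real.cosh (Real.exp (-m))) ×ℂ
        Icc (-Real.sinh (Real.exp (-m))) (Real.sinh (Real.exp (-m)))) ?_
    exact fun w hw => ⟨abs_le.1 hw.1, abs_le.1 hw.2⟩
  have hgB : ∀ m, closure (g '' H m) ⊆ (fun z : ℂ => T.eval z) ⁻¹' B m := by
    intro m
    refine closure_minimal ?_ ((hBcl m).preimage T.continuous)
    rintro _ ⟨s, hs, rfl⟩
    simp only [mem_preimage, hg]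
    exact joukowski_bounds hs
  have hlim : Tendsto (fun m : ℕ => Real.exp (-m)) atTop (𝓝 0) :=
    Real.tendsto_exp_neg_atTop_nhds_zero.comp tendsto_natCast_atTop_atTop
  have hK : (fun z : ℂ => T.eval z) ⁻¹' unitSegment = ⋂ m, closure (g '' H m) := by
    apply Subset.antisymm
    · refine subset_iInter fun m z hz => ?_
      rw [mem_closure_iff]
      intro o ho hzo
      -- W is an open neighbourhood of [-1,1]. As T is open and [-1,1] has empty interior,
      -- arbitrarily near z there are points with values in W off [-1,1]; these lie in g '' H m.
      set W : Set ℂ := Complex.cosh '' {ζ | |ζ.re| < Real.exp (-m)} with hW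
      have hWo : IsOpen W :=
        Complex.isOpenMap_cosh _ (isOpen_lt (by fun_prop) continuous_const)
      have hzW : T.eval z ∈ W := by
        obtain ⟨x, hx, hxz⟩ := hz
        simp only at hxz
        refine ⟨Real.arccos x * Complex.I, ?_, ?_⟩
        · simpa using Real.exp_pos _
        · rw [Complex.cosh_mul_I, ← Complex.ofReal_cos, Real.cos_arccos hx.1 hx.2, hxz]
      have hopen := isOpenMap_eval hT _ (ho.inter (hWo.preimage T.continuous))
      have hdense : Dense unitSegmentᶜ := interior_eq_empty_iff_dense_compl.1 interior_unitSegment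
      obtain ⟨_, ⟨w, ⟨hwo, hwW⟩, rfl⟩, hw⟩ := hdense.inter_open_nonempty _ hopen
        ⟨_, z, ⟨hzo, hzW⟩, rfl⟩
      obtain ⟨ζ, hζ, hζw⟩ := hwW
      simp only at hw hζw
      rw [← hζw] at hw
      obtain ⟨s, hs, hsζ⟩ := exists_joukowski_eq_cosh hw
      obtain ⟨k, rfl⟩ := exists_eq_joukowski_lift hT hcrit hg (hζw.symm.trans hs.symm)
      refine ⟨_, hwo, _, ?_, rfl⟩
      have : s.re < -m := Real.exp_lt_exp.1 (hsζ ▸ hζ)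
      simpa [hH] using this
    · intro z hz
      have hz' : ∀ m, T.eval z ∈ B m := fun m => hgB m (mem_iInter.1 hz m)
      rw [mem_preimage, mem_unitSegment]
      constructor
      · have h1 : Tendsto (fun m : ℕ => Real.cosh (Real.exp (-m))) atTop (𝓝 1) := by
          simpa [Function.comp_def] using (Real.continuous_cosh.tendsto 0).comp hlim
        exact ge_of_tendsto' h1 fun m => (hz' m).1
      · have h1 : Tendsto (fun m : ℕ => Real.sinh (Real.exp (-m))) atTop (𝓝 0) := by
          simpa [Function.comp_def] using (Real.continuous_sinh.tendsto 0).comp hlim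
        have := ge_of_tendsto' h1 fun m => (hz' m).2
        exact abs_nonpos_iff.1 this
  refine ⟨?_, ?_⟩
  · obtain ⟨z, hz⟩ := exists_eval_eq hdeg 0
    refine ⟨z, ?_⟩
    rw [mem_preimage, mem_unitSegment]
    simp [hz]
  · rw [hK]
    refine isPreconnected_iInter_of_antitone ?_ (fun m => ?_) fun m => ?_
    · intro m m' h
      refine closure_mono (image_mono fun s hs => ?_)
      have : (m : ℝ) ≤ m' := by exact_mod_cast h
      simp only [hH, mem_ofPred_eq] at hs ⊢
      linarith
    · exact ((T.isProperMap_eval hdeg).isCompact_preimage (hBcomp m)).of_isClosed_subset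
        isClosed_closure (hgB m)
    · refine IsPreconnected.closure ?_
      exact (convex_halfSpace_re_lt _).isPreconnected.image _ g.continuous.continuousOn

/-! ### Arcs over real intervals -/

/-- A continuous function whose image under a polynomial converges has a limit itself, along
filters with arbitrarily small preconnected sets. -/
theorem Polynomial.exists_tendsto_of_tendsto_eval {T : ℂ[X]} (hT : 0 < T.degree)
    {A : Type*} [TopologicalSpace A] {l : Filter A} [l.NeBot] {s : A → ℂ}
    (hl : ∀ U ∈ l, ∃ V ∈ l, V ⊆ U ∧ IsPreconnected V ∧ ContinuousOn s V) {w : ℂ}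
    (hw : Tendsto (fun t => T.eval (s t)) l (𝓝 w)) :
    ∃ z, T.eval z = w ∧ Tendsto s l (𝓝 z) := by
  have hK : IsCompact ((fun z => T.eval z) ⁻¹' Metric.closedBall w 1) :=
    (T.isProperMap_eval hT).isCompact_preimage (isCompact_closedBall w 1)
  have hsK : ∀ᶠ t in l, s t ∈ (fun z => T.eval z) ⁻¹' Metric.closedBall w 1 :=
    hw.eventually (Metric.closedBall_mem_nhds w one_pos)
  obtain ⟨z, -, hz⟩ := hK.exists_mapClusterPt (Filter.le_principal_iff.2 hsK)
  have hlim : Tendsto s l (𝓝 z) := by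
    rw [Metric.tendsto_nhds]
    intro ε hε
    have hT0 : T - C w ≠ 0 := by
      intro h
      rw [sub_eq_zero] at h
      exact (h ▸ hT).not_ge degree_C_le
    -- The sphere of radius r misses the finite fibre over w, so eventually s cannot cross it; s
    -- enters the ball since z is a cluster point.
    obtain ⟨r, ⟨hr0, hrε⟩, hr⟩ : ∃ r ∈ Ioo 0 ε,
        r ∉ (fun y => dist y z) '' {y | T.eval y = w} := by
      have hfin : {y | T.eval y = w}.Finite :=
        (T - C w).roots.toFinset.finite_toSet.subset fun y hy => by
          simpa [hT0, sub_eq_zero] using hy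
      obtain ⟨r, hr, hr'⟩ := (Ioo_infinite hε).exists_notMem_finite
        (hfin.image fun y => dist y z)
      exact ⟨r, hr, hr'⟩
    have hcl : IsClosed ((fun y => T.eval y) '' Metric.sphere z r) :=
      ((isCompact_sphere z r).image T.continuous).isClosed
    have hwn : w ∉ (fun y => T.eval y) '' Metric.sphere z r := by
      rintro ⟨y, hy, hyw⟩
      exact hr ⟨y, hyw, hy⟩
    obtain ⟨V, hV, hVU, hVc, hVs⟩ := hl _ (hw.eventually (hcl.isOpen_compl.mem_nhds hwn))
    have hfreq : ∃ᶠ t in l, dist (s t) z < r :=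
      (mapClusterPt_iff_frequently.1 hz) _ (Metric.ball_mem_nhds z hr0)
    obtain ⟨t₀, ht₀, ht₀V⟩ := (hfreq.and_eventually hV).exists
    filter_upwards [hV] with t ht
    by_contra hcon
    obtain ⟨t', ht', h⟩ := hVc.intermediate_value ht₀V ht (f := fun t => dist (s t) z)
      (continuous_id.dist continuous_const |>.comp_continuousOn hVs) ⟨ht₀.le, (hrε.le.trans (not_lt.1 hcon))⟩
    exact hVU ht' ⟨s t', h, rfl⟩
  exact ⟨z, tendsto_nhds_unique ((T.continuous.tendsto z).comp hlim) hw, hlim⟩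

/-- Over a real interval without critical values in its interior, every point of the preimage
lies on an arc that the polynomial maps homeomorphically to the interval. -/
theorem Polynomial.exists_arc {T : ℂ[X]} (hT : 0 < T.degree) {a b m : ℝ}
    (hcrit : ∀ t ∈ Ioo a b, ∀ z, T.derivative.eval z = 0 → T.eval z ≠ (t : ℂ))
    (hm : m ∈ Ioo a b) {z : ℂ} (hz : T.eval z = m) :
    ∃ s : ℝ → ℂ, ContinuousOn s (Icc a b) ∧ (∀ t ∈ Icc a b, T.eval (s t) = t) ∧ s m = z := by
  have hab : a < b := hm.1.trans hm.2
  have : ContractibleSpace (Ioo a b) := (convex_Ioo a b).contractibleSpace ⟨m, hm⟩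
  have : LocallyPathConnectedSpace (Ioo a b) := isOpen_Ioo.locallyPathConnectedSpace
  let f : C(Ioo a b, ℂ) := ⟨fun t => ((t : ℝ) : ℂ), by fun_prop⟩
  obtain ⟨g, hgm, hg⟩ := T.exists_lift f (fun t w hw => hcrit t t.2 w hw) (a := ⟨m, hm⟩) hz
  set s₀ : ℝ → ℂ := fun t => if h : t ∈ Ioo a b then g ⟨t, h⟩ else 0 with hs₀
  have hs₀g : (Ioo a b).domRestrict s₀ = g := by
    funext t
    simp only [hs₀, domRestrict_apply, dif_pos t.2]
  have hs₀c : ContinuousOn s₀ (Ioo a b) := by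
    rw [continuousOn_iff_continuous_domRestrict, hs₀g]
    exact g.continuous
  have hs₀T : ∀ t ∈ Ioo a b, T.eval (s₀ t) = t := by
    intro t ht
    simp only [hs₀, dif_pos ht]
    exact hg ⟨t, ht⟩
  -- The endpoints may be critical values, where lifting fails; the arc is extended to them by
  -- limits.
  obtain ⟨zb, hzb, hb⟩ := exists_tendsto_of_tendsto_eval hT (l := 𝓝[<] b) (s := s₀) (w := b)
    (fun U hU => by
      obtain ⟨c, hc, hcU⟩ := (mem_nhdsLT_iff_exists_mem_Ico_Ioo_subset hab).1 hU
      exact ⟨_, Ioo_mem_nhdsLT hc.2, hcU, isPreconnected_Ioo,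
        hs₀c.mono (Ioo_subset_Ioo_left hc.1)⟩)
    (((Complex.continuous_ofReal.tendsto b).mono_left nhdsWithin_le_nhds).congr' (by
      filter_upwards [Ioo_mem_nhdsLT hab] with t ht using (hs₀T t ht).symm))
  obtain ⟨za, hza, ha⟩ := exists_tendsto_of_tendsto_eval hT (l := 𝓝[>] a) (s := s₀) (w := a)
    (fun U hU => by
      obtain ⟨c, hc, hcU⟩ := (mem_nhdsGT_iff_exists_mem_Ioc_Ioo_subset hab).1 hU
      exact ⟨_, Ioo_mem_nhdsGT hc.1, hcU, isPreconnected_Ioo,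
        hs₀c.mono (Ioo_subset_Ioo_right hc.2)⟩)
    (((Complex.continuous_ofReal.tendsto a).mono_left nhdsWithin_le_nhds).congr' (by
      filter_upwards [Ioo_mem_nhdsGT hab] with t ht using (hs₀T t ht).symm))
  have hext : ∀ t ∈ Ioo a b, extendFrom (Ioo a b) s₀ t = s₀ t := fun t ht =>
    extendFrom_eq (subset_closure ht) (hs₀c t ht)
  refine ⟨extendFrom (Ioo a b) s₀, continuousOn_Icc_extendFrom_Ioo hs₀c ha hb, ?_, ?_⟩
  · intro t ht
    rcases eq_endpoints_or_mem_Ioo_of_mem_Icc ht with rfl | rfl | h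
    · rw [eq_lim_at_left_extendFrom_Ioo hab ha, hza]
    · rw [eq_lim_at_right_extendFrom_Ioo hab hb, hzb]
    · rw [hext t h, hs₀T t h]
  · rw [hext m hm]
    simp only [hs₀, dif_pos hm, hgm]

/-- Two arcs over an interval without critical values in its interior that meet over the interior
agree there. -/
theorem Polynomial.arc_unique {T : ℂ[X]} {a b : ℝ}
    (hcrit : ∀ t ∈ Ioo a b, ∀ z, T.derivative.eval z = 0 → T.eval z ≠ (t : ℂ))
    {s s' : ℝ → ℂ} (hs : ContinuousOn s (Icc a b)) (hs' : ContinuousOn s' (Icc a b))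
    (hsT : ∀ t ∈ Icc a b, T.eval (s t) = t) (hsT' : ∀ t ∈ Icc a b, T.eval (s' t) = t)
    {t : ℝ} (ht : t ∈ Ioo a b) (h : s t = s' t) : EqOn s s' (Ioo a b) := by
  have : ContractibleSpace (Ioo a b) := (convex_Ioo a b).contractibleSpace ⟨t, ht⟩
  have : LocallyPathConnectedSpace (Ioo a b) := isOpen_Ioo.locallyPathConnectedSpace
  let f : C(Ioo a b, ℂ) := ⟨fun t => ((t : ℝ) : ℂ), by fun_prop⟩
  let g : C(Ioo a b, ℂ) := ⟨(Ioo a b).domRestrict s,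
    continuousOn_iff_continuous_domRestrict.1 (hs.mono Ioo_subset_Icc_self)⟩
  let g' : C(Ioo a b, ℂ) := ⟨(Ioo a b).domRestrict s',
    continuousOn_iff_continuous_domRestrict.1 (hs'.mono Ioo_subset_Icc_self)⟩
  have hgg : g = g' := T.lift_unique f (fun t w hw => hcrit t t.2 w hw)
    (fun t => hsT t (Ioo_subset_Icc_self t.2)) (fun t => hsT' t (Ioo_subset_Icc_self t.2))
    (a := ⟨t, ht⟩) h
  exact fun u hu => DFunLike.congr_fun hgg ⟨u, hu⟩

/-! ### Counting vertices, edges and critical points -/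

/-- A connected union of a finite set of vertices and of finitely many closed edges meeting only
in their ends has at most one vertex more than it has edges. -/
theorem card_vertices_le_of_isPreconnected {X : Type*} [TopologicalSpace X] [T1Space X]
    {V : Set X} (hV : V.Finite) {ι : Type*} [Finite ι] (p q : ι → V) (A : ι → Set X)
    (hA : ∀ i, IsClosed (A i))
    (hAV : ∀ i, ∀ x ∈ A i, x ∈ V → x = p i ∨ x = q i)
    (hAA : ∀ i j, i ≠ j → A i ∩ A j ⊆ V) (hconn : IsPreconnected (V ∪ ⋃ i, A i)) :
    Nat.card V ≤ Nat.card ι + 1 := by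
  have := hV.to_subtype
  rcases isEmpty_or_nonempty V with hemp | hne
  · simp
  -- Loops and parallel edges are lost here, which only lowers the number of edges.
  let G : SimpleGraph V := SimpleGraph.fromRel fun u v => ∃ i, u = p i ∧ v = q i
  have hpq : ∀ i, G.Reachable (p i) (q i) := by
    intro i
    by_cases h : p i = q i
    · rw [h]
    · exact SimpleGraph.Adj.reachable ((SimpleGraph.fromRel_adj _ _ _).2 ⟨h, .inl ⟨i, rfl, rfl⟩⟩)
  have hcard : Nat.card G.edgeSet ≤ Nat.card ι := by
    have hsub : G.edgeSet ⊆ range fun i => s(p i, q i) := by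
      intro e
      induction e using Sym2.ind with
      | _ u v =>
        intro h
        rw [SimpleGraph.mem_edgeSet, SimpleGraph.fromRel_adj] at h
        rcases h.2 with ⟨i, rfl, rfl⟩ | ⟨i, rfl, rfl⟩
        · exact ⟨i, rfl⟩
        · exact ⟨i, Sym2.eq_swap⟩
    exact (Nat.card_mono (finite_range _) hsub).trans (Finite.card_range_le _)
  have hG : G.Connected := by
    rw [SimpleGraph.connected_iff]
    refine ⟨fun u v => ?_, hne⟩
    by_contra huv
    have hreach : ∀ i, ∀ x : V, (x : X) ∈ A i → (G.Reachable u x ↔ G.Reachable u (p i)) := by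
      intro i x hx
      rcases hAV i x hx x.2 with h | h
      · rw [Subtype.ext h]
      · rw [Subtype.ext h]
        exact ⟨fun h => h.trans (hpq i).symm, fun h => h.trans (hpq i)⟩
    -- F and F' gather the vertices and edges in and out of the component of u: two disjoint closed
    -- sets.
    set F : Set X := ((↑) '' {x : V | G.Reachable u x}) ∪ ⋃ i ∈ {i | G.Reachable u (p i)}, A i
      with hF
    set F' : Set X := ((↑) '' {x : V | ¬ G.Reachable u x}) ∪
      ⋃ i ∈ {i | ¬ G.Reachable u (p i)}, A i with hF'
    have hFc : IsClosed F := (toFinite _).isClosed.union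
      ((toFinite _).isClosed_biUnion fun i _ => hA i)
    have hFc' : IsClosed F' := (toFinite _).isClosed.union
      ((toFinite _).isClosed_biUnion fun i _ => hA i)
    have hcov : (V ∪ ⋃ i, A i) ⊆ F ∪ F' := by
      rintro x (hx | hx)
      · by_cases h : G.Reachable u ⟨x, hx⟩
        · exact .inl (.inl ⟨⟨x, hx⟩, h, rfl⟩)
        · exact .inr (.inl ⟨⟨x, hx⟩, h, rfl⟩)
      · obtain ⟨i, hi⟩ := mem_iUnion.1 hx
        by_cases h : G.Reachable u (p i)
        · exact .inl (.inr (mem_biUnion (show i ∈ {i | G.Reachable u (p i)} from h) hi))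
        · exact .inr (.inr (mem_biUnion (show i ∈ {i | ¬ G.Reachable u (p i)} from h) hi))
    obtain ⟨x, -, hxF, hxF'⟩ := isPreconnected_closed_iff.1 hconn F F' hFc hFc' hcov
      ⟨u, .inl u.2, .inl ⟨u, .refl u, rfl⟩⟩ ⟨v, .inl v.2, .inl ⟨v, huv, rfl⟩⟩
    rcases hxF with ⟨y, hy, rfl⟩ | hxF
    · rcases hxF' with ⟨y', hy', h⟩ | hxF'
      · rw [Subtype.ext h] at hy'
        exact hy' hy
      · obtain ⟨i, hi, hxi⟩ := mem_iUnion₂.1 hxF'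
        exact hi ((hreach i y hxi).1 hy)
    · obtain ⟨j, hj, hxj⟩ := mem_iUnion₂.1 hxF
      rcases hxF' with ⟨y', hy', rfl⟩ | hxF'
      · exact hy' ((hreach j y' hxj).2 hj)
      · obtain ⟨i, hi, hxi⟩ := mem_iUnion₂.1 hxF'
        have hij : i ≠ j := by
          rintro rfl
          exact hi hj
        have hxV := hAA i j hij ⟨hxi, hxj⟩
        exact hi ((hreach i ⟨x, hxV⟩ hxi).1 ((hreach j ⟨x, hxV⟩ hxj).2 hj))
  exact hG.card_vert_le_card_edgeSet_add_one.trans (Nat.add_le_add_right hcard 1)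

/-- The number of points in a fibre of a polynomial, increased by the number of critical points
in the fibre, is the degree. -/
theorem Polynomial.card_roots_toFinset_add_sum_count_derivative {T : ℂ[X]} (hT : 0 < T.degree)
    (w : ℂ) : (T - C w).roots.toFinset.card +
      ∑ z ∈ (T - C w).roots.toFinset, T.derivative.roots.count z = T.natDegree := by
  have hT0 : T - C w ≠ 0 := by
    intro h
    rw [sub_eq_zero] at h
    exact (h ▸ hT).not_ge degree_C_le
  have h1 : Multiset.card (T - C w).roots = T.natDegree := by
    rw [IsAlgClosed.card_roots_eq_natDegree, natDegree_sub_C]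
  rw [← h1, ← Multiset.toFinset_sum_count_eq, Finset.card_eq_sum_ones, ← Finset.sum_add_distrib]
  refine Finset.sum_congr rfl fun z hz => ?_
  have hz' := Multiset.mem_toFinset.1 hz
  -- A root of multiplicity m contributes 1 + (m - 1).
  have hd := derivative_rootMultiplicity_of_root ((mem_roots hT0).1 hz')
  have hpos := Multiset.count_pos.2 hz'
  rw [derivative_sub, derivative_C, sub_zero] at hd
  rw [count_roots] at hpos ⊢
  rw [count_roots, hd]
  omega

/-! ### A connected preimage contains the critical points -/

/-- If the preimage of `[-1, 1]` under a nonconstant polynomial is connected, then it contains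
all critical points. -/
theorem Polynomial.eval_mem_unitSegment_of_isConnected_preimage {T : ℂ[X]} (hT : 0 < T.degree)
    (hconn : IsPreconnected ((fun z : ℂ => T.eval z) ⁻¹' unitSegment))
    {z₀ : ℂ} (hz₀ : T.derivative.eval z₀ = 0) : T.eval z₀ ∈ unitSegment := by
  by_contra hz₀K
  have hnat : 0 < T.natDegree := natDegree_pos_iff_degree_pos.2 hT
  have hT' : T.derivative ≠ 0 := fun h => hnat.ne' (derivative_eq_zero.1 h)
  have hmem : ∀ (x : ℝ) (z : ℂ), z ∈ (T - C (x : ℂ)).roots.toFinset ↔ T.eval z = x := by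
    intro x z
    have hT0 : T - C (x : ℂ) ≠ 0 := by
      intro h
      rw [sub_eq_zero] at h
      exact (h ▸ hT).not_ge degree_C_le
    rw [Multiset.mem_toFinset, mem_roots hT0, IsRoot, eval_sub, eval_C, sub_eq_zero]
  classical
  -- Real parts of nonreal critical values may enter as well; they only refine the subdivision.
  let Y : Finset ℝ := ((T.derivative.roots.toFinset.image fun z => (T.eval z).re) ∪ {-1, 1}).filter
    (· ∈ Icc (-1 : ℝ) 1)
  have hXI : ∀ x ∈ Y, x ∈ Icc (-1 : ℝ) 1 := fun x hx => (Finset.mem_filter.1 hx).2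
  have hX1 : (1 : ℝ) ∈ Y := by simp [Y]
  have hXm1 : (-1 : ℝ) ∈ Y := by simp [Y]
  have hXcrit : ∀ x ∈ Icc (-1 : ℝ) 1, ∀ z, T.derivative.eval z = 0 → T.eval z = x → x ∈ Y := by
    intro x hx z hz hzx
    refine Finset.mem_filter.2 ⟨Finset.mem_union_left _ (Finset.mem_image.2 ⟨z, ?_, ?_⟩), hx⟩
    · rw [Multiset.mem_toFinset, mem_roots hT']
      exact hz
    · rw [hzx, Complex.ofReal_re]
  have hnext : ∀ x ∈ Y.erase 1, ∃ y ∈ Y, x < y ∧ ∀ u ∈ Y, x < u → y ≤ u := by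
    intro x hx
    have hx' := Finset.mem_erase.1 hx
    have hne : (Y.filter (x < ·)).Nonempty :=
      ⟨1, Finset.mem_filter.2 ⟨hX1, lt_of_le_of_ne (hXI x hx'.2).2 hx'.1⟩⟩
    have hmin := Finset.mem_filter.1 (Finset.min'_mem _ hne)
    exact ⟨_, hmin.1, hmin.2, fun u hu hxu => Finset.min'_le _ _ (Finset.mem_filter.2 ⟨hu, hxu⟩)⟩
  choose! next hnX hlt hle using hnext
  let mid : ℝ → ℝ := fun x => (x + next x) / 2
  have hmid : ∀ x ∈ Y.erase 1, mid x ∈ Ioo x (next x) := by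
    intro x hx
    have := hlt x hx
    constructor <;> simp only [mid] <;> linarith
  have hnotX : ∀ x ∈ Y.erase 1, ∀ t ∈ Ioo x (next x), t ∉ Y := fun x hx t ht htX =>
    (hle x hx t htX ht.1).not_gt ht.2
  have hsubI : ∀ x ∈ Y.erase 1, Icc x (next x) ⊆ Icc (-1 : ℝ) 1 := fun x hx =>
    Icc_subset_Icc (hXI x (Finset.mem_of_mem_erase hx)).1 (hXI _ (hnX x hx)).2
  have hncrit : ∀ x ∈ Y.erase 1, ∀ t ∈ Ioo x (next x), ∀ z, T.derivative.eval z = 0 →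
      T.eval z ≠ (t : ℂ) := fun x hx t ht z hz hzt =>
    hnotX x hx t ht (hXcrit t (hsubI x hx (Ioo_subset_Icc_self ht)) z hz hzt)
  have hcover : ∀ t ∈ Icc (-1 : ℝ) 1, t ∉ Y → ∃ x ∈ Y.erase 1, t ∈ Ioo x (next x) := by
    intro t ht htX
    have hne : (Y.filter (· < t)).Nonempty :=
      ⟨-1, Finset.mem_filter.2 ⟨hXm1, lt_of_le_of_ne ht.1 (by rintro rfl; exact htX hXm1)⟩⟩
    obtain ⟨hmX, hmt⟩ := Finset.mem_filter.1 (Finset.max'_mem _ hne)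
    set x := (Y.filter (· < t)).max' hne
    have hx : x ∈ Y.erase 1 := Finset.mem_erase.2 ⟨(hmt.trans_le ht.2).ne, hmX⟩
    refine ⟨x, hx, hmt, ?_⟩
    by_contra hcon
    have hlt' : next x < t := lt_of_le_of_ne (not_lt.1 hcon) fun h => htX (h ▸ hnX x hx)
    exact (hlt x hx).not_ge (Finset.le_max' _ _ (Finset.mem_filter.2 ⟨hnX x hx, hlt'⟩))
  let V : Finset ℂ := Y.biUnion fun x => (T - C (x : ℂ)).roots.toFinset
  have hV : ∀ z, z ∈ V ↔ ∃ x ∈ Y, T.eval z = x := by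
    intro z
    simp only [V, Finset.mem_biUnion, hmem]
  -- An edge is labelled by its interval's left end and its point over the midpoint, which
  -- determines the arc.
  let E : Finset (Σ _ : ℝ, ℂ) :=
    (Y.erase 1).sigma fun x => (T - C (mid x : ℂ)).roots.toFinset
  have harc : ∀ e : E, ∃ s : ℝ → ℂ, ContinuousOn s (Icc e.1.1 (next e.1.1)) ∧
      (∀ t ∈ Icc e.1.1 (next e.1.1), T.eval (s t) = t) ∧ s (mid e.1.1) = e.1.2 := by
    rintro ⟨⟨x, w⟩, he⟩
    obtain ⟨hx, hw⟩ := Finset.mem_sigma.1 he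
    exact exists_arc hT (hncrit x hx) (hmid x hx) ((hmem _ _).1 hw)
  choose s hsc hsT hsm using harc
  have hE : ∀ e : E, e.1.1 ∈ Y.erase 1 := fun e => (Finset.mem_sigma.1 e.2).1
  let A : E → Set ℂ := fun e => s e '' Icc e.1.1 (next e.1.1)
  have hcrossing : ∀ (e : E) (x : ℂ), x ∈ A e → x ∉ V →
      ∃ t ∈ Ioo e.1.1 (next e.1.1), s e t = x := by
    rintro e _ ⟨t, ht, rfl⟩ hV'
    rcases eq_endpoints_or_mem_Ioo_of_mem_Icc ht with rfl | rfl | h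
    · exact (hV' ((hV _).2 ⟨_, Finset.mem_of_mem_erase (hE e), hsT e _ ht⟩)).elim
    · exact (hV' ((hV _).2 ⟨_, hnX _ (hE e), hsT e _ ht⟩)).elim
    · exact ⟨t, h, rfl⟩
  have hend : ∀ e : E, e.1.1 ∈ Icc e.1.1 (next e.1.1) ∧ next e.1.1 ∈ Icc e.1.1 (next e.1.1) :=
    fun e => ⟨left_mem_Icc.2 (hlt _ (hE e)).le, right_mem_Icc.2 (hlt _ (hE e)).le⟩
  let p : E → (V : Set ℂ) := fun e => ⟨s e e.1.1,
    (hV _).2 ⟨_, Finset.mem_of_mem_erase (hE e), hsT e _ (hend e).1⟩⟩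
  let q : E → (V : Set ℂ) := fun e => ⟨s e (next e.1.1),
    (hV _).2 ⟨_, hnX _ (hE e), hsT e _ (hend e).2⟩⟩
  have hK : (fun z : ℂ => T.eval z) ⁻¹' unitSegment = (V : Set ℂ) ∪ ⋃ e, A e := by
    apply Subset.antisymm
    · rintro z ⟨t, ht, htz⟩
      by_cases htX : t ∈ Y
      · exact .inl ((hV z).2 ⟨t, htX, htz.symm⟩)
      · obtain ⟨x, hx, htx⟩ := hcover t ht htX
        obtain ⟨σ, hσc, hσT, hσt⟩ := exists_arc hT (hncrit x hx) htx htz.symm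
        have hm := hmid x hx
        let e : E := ⟨⟨x, σ (mid x)⟩, Finset.mem_sigma.2
          ⟨hx, (hmem _ _).2 (hσT _ (Ioo_subset_Icc_self hm))⟩⟩
        have heq := arc_unique (hncrit x hx) (hsc e) hσc (hsT e) hσT hm (hsm e)
        exact .inr (mem_iUnion.2 ⟨e, t, Ioo_subset_Icc_self htx, (heq htx).trans hσt⟩)
    · refine union_subset (fun z hz => ?_) (iUnion_subset fun e => ?_)
      · obtain ⟨x, hx, hzx⟩ := (hV z).1 hz
        exact ⟨x, hXI x hx, hzx.symm⟩
      · rintro _ ⟨t, ht, rfl⟩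
        exact ⟨t, hsubI _ (hE e) ht, (hsT e t ht).symm⟩
  have hgraph := card_vertices_le_of_isPreconnected V.finite_toSet p q A
    (fun e => (isCompact_Icc.image_of_continuousOn (hsc e)).isClosed)
    (by
      rintro e _ ⟨t, ht, rfl⟩ htV
      rcases eq_endpoints_or_mem_Ioo_of_mem_Icc ht with h | h | h
      · exact .inl (by rw [h])
      · exact .inr (by rw [h])
      · obtain ⟨x, hx, htx⟩ := (hV _).1 htV
        rw [hsT e t ht, Complex.ofReal_inj] at htx
        exact (hnotX _ (hE e) t h (htx ▸ hx)).elim)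
    (by
      intro e e' hne z hz
      by_contra hzV
      obtain ⟨t, ht, hst⟩ := hcrossing e z hz.1 hzV
      obtain ⟨t', ht', hst'⟩ := hcrossing e' z hz.2 hzV
      have h1 := hsT e t (Ioo_subset_Icc_self ht)
      have h2 := hsT e' t' (Ioo_subset_Icc_self ht')
      rw [hst] at h1
      rw [hst', h1, Complex.ofReal_inj] at h2
      subst h2
      have hxx : e.1.1 = e'.1.1 := by
        by_contra hxx
        rcases lt_or_gt_of_ne hxx with h | h
        · exact (hle _ (hE e) _ (Finset.mem_of_mem_erase (hE e')) h).not_gt (ht'.1.trans ht.2)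
        · exact (hle _ (hE e') _ (Finset.mem_of_mem_erase (hE e)) h).not_gt (ht.1.trans ht'.2)
      have hc' := hsc e'
      have hT'' := hsT e'
      have hm' := hsm e'
      rw [← hxx] at hc' hT'' hm'
      have heq := arc_unique (hncrit _ (hE e)) (hsc e) hc' (hsT e) hT'' ht
        (hst.trans hst'.symm) (hmid _ (hE e))
      rw [hsm e, hm'] at heq
      exact hne (Subtype.ext (Sigma.ext hxx (heq_of_eq heq))))
    (hK ▸ hconn)
  have hEcard : E.card ≤ (Y.card - 1) * T.natDegree := by
    rw [Finset.card_sigma, ← Finset.card_erase_of_mem hX1, ← smul_eq_mul]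
    exact Finset.sum_le_card_nsmul _ _ _ fun x _ => by
      have := card_roots_toFinset_add_sum_count_derivative hT (mid x : ℂ)
      omega
  have hdisj : (Y : Set ℝ).PairwiseDisjoint fun x => (T - C (x : ℂ)).roots.toFinset := by
    intro x _ y _ hxy
    refine Finset.disjoint_left.2 fun z hz hz' => hxy ?_
    rw [hmem] at hz hz'
    exact_mod_cast hz.symm.trans hz'
  have hVcard : V.card + ∑ z ∈ V, T.derivative.roots.count z = Y.card * T.natDegree := by
    rw [Finset.card_biUnion hdisj, Finset.sum_biUnion hdisj, ← Finset.sum_add_distrib, ← smul_eq_mul]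
    exact Finset.sum_eq_card_nsmul fun x _ => card_roots_toFinset_add_sum_count_derivative hT x
  have hz₀V : z₀ ∉ V := fun h => by
    obtain ⟨x, hx, hzx⟩ := (hV z₀).1 h
    exact hz₀K ⟨x, hXI x hx, hzx.symm⟩
  have hcount : ∑ z ∈ V, T.derivative.roots.count z + 1 ≤ T.natDegree - 1 := by
    have h0 : 1 ≤ T.derivative.roots.count z₀ :=
      Multiset.count_pos.2 ((mem_roots hT').2 hz₀)
    calc _ ≤ ∑ z ∈ insert z₀ V, T.derivative.roots.count z := by
          rw [Finset.sum_insert hz₀V]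
          omega
      _ ≤ ∑ z ∈ insert z₀ V ∪ T.derivative.roots.toFinset, T.derivative.roots.count z :=
          Finset.sum_le_sum_of_subset Finset.subset_union_left
      _ = Multiset.card T.derivative.roots :=
          Multiset.sum_count_eq_card fun z hz =>
            Finset.mem_union_right _ (Multiset.mem_toFinset.2 hz)
      _ ≤ T.derivative.natDegree := card_roots' _
      _ ≤ T.natDegree - 1 := natDegree_derivative_le T
  have h1 : Nat.card (V : Set ℂ) = V.card := by simp
  have h2 : Nat.card E = E.card := by simp
  rw [h1, h2] at hgraph
  have hXpos : 0 < Y.card := Finset.card_pos.2 ⟨1, hX1⟩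
  obtain ⟨N, hN⟩ : ∃ N, Y.card = N + 1 := ⟨Y.card - 1, by omega⟩
  rw [hN, Nat.add_sub_cancel] at hEcard
  rw [hN, add_mul, one_mul] at hVcard
  omega

theorem theorem4 (n : ℕ) (T : Polynomial ℂ) (hT : T.degree = (n : WithBot ℕ)) :
    IsConnected ((fun z : ℂ => T.eval z) ⁻¹' ((fun x : ℝ => (x : ℂ)) '' Set.Icc (-1 : ℝ) 1)) ↔
      {z : ℂ | T.derivative.eval z = 0} ⊆
        (fun z : ℂ => T.eval z) ⁻¹' ((fun x : ℝ => (x : ℂ)) '' Set.Icc (-1 : ℝ) 1) := by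
  change IsConnected ((fun z : ℂ => T.eval z) ⁻¹' unitSegment) ↔
    {z : ℂ | T.derivative.eval z = 0} ⊆ (fun z : ℂ => T.eval z) ⁻¹' unitSegment
  rcases Nat.eq_zero_or_pos n with rfl | hn
  -- For constant T every point is critical and the preimage is empty or the whole plane;
  -- nonemptiness in `IsConnected` decides the empty case.
  · have hC := eq_C_of_degree_le_zero hT.le
    generalize T.coeff 0 = c at hC
    subst hC
    simp only [eval_C, derivative_C, eval_zero]
    by_cases hc : c ∈ unitSegment
    · simpa [preimage_const_of_mem hc] using isConnected_univ (α := ℂ)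
    · rw [preimage_const_of_notMem hc]
      constructor
      · exact fun h => (h.nonempty.ne_empty rfl).elim
      · exact fun h => (h (a := 0) trivial).elim
  · have hdeg : 0 < T.degree := by
      rw [hT]
      exact_mod_cast hn
    constructor
    · exact fun h z hz => eval_mem_unitSegment_of_isConnected_preimage hdeg h.isPreconnected hz
    · exact fun h => isConnected_preimage_unitSegment
        (natDegree_pos_iff_degree_pos.2 hdeg).ne' fun z hz => h hz
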